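/- **Setting.** An $\mathfrak{sl}_2$ triad on $\mathbb{R}^n$ is a triple $(X,Y,Z)$ of real $n\times n$ matrices with $[X,Y]=Z$, $[Z,X]=2X$, $[Z,Y]=-2Y$. For a matrix $A$ let $\mathcal{D}_Af(\mathbf{x})=f'(\mathbf{x})A\mathbf{x}$ on $\mathbb{R}[[\mathbf{x}]]$, and put $\mathcal{X}=\mathcal{D}_Y$, $\mathcal{Y}=\mathcal{D}_X$, $\mathcal{Z}=\mathcal{D}_Z$. The formal invariants of the triad are $\mathcal{J}=\ker\mathcal{X}\subset\mathbb{R}[[\mathbf{x}]]$, and the polynomial invariants are $\mathcal{J}\cap\mathbb{R}[\mathbf{x}]$. A weight invariant is a nonzero $f\in\mathcal{J}$ with $\mathcal{Z}f=\widehat f f$ for a scalar $\widehat f$, its weight; the weight of a polynomial weight invariant is a nonnegative integer. A Hilbert basis is a finite list $\alpha=(\alpha_1,\dots,\alpha_p)$ of homogeneous polynomial weight invariants such that every element of $\mathcal{J}\cap\mathbb{R}[\mathbf{x}]$ is a polynomial in $\alpha_1,\dots,\alpha_p$. For $\mathbf{k}\in\mathbb{N}^p$ write $\alpha^{\mathbf{k}}=\alpha_1^{k_1}\cdots\alpha_p^{k_p}$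 and $\widehat\alpha\mathbf{k}=\sum_i\widehat{\alpha_i}k_i$. A family $(v_i)_{i\in I}$ of formal power series is a formal (vector space) basis of a space $V$ of formal power series if $I$ is countable, each monomial occurs in only finitely many $v_i$, and $(c_i)_{i \in I}\mapsto\sum_i c_iv_i$ is a bijection from $\mathbb{R}^I$ onto $V$. A standard preferred set for $\mathcal{J}$ with respect to $\alpha$ is a set $A\subset\mathbb{N}^p$ such that $\{\mathbf{t}^{\mathbf{k}}:\mathbf{k}\in A\}$ is the set of all monomials not lying in some monomial ideal of $\mathbb{R}[t_1,\dots,t_p]$, and $(\alpha^{\mathbf{k}})_{\mathbf{k}\in A}$ is a formal basis of $\mathcal{J}$. Let $(\acute X,\acute Y,\acute Z)$ and $(\grave X,\grave Y,\grave Z)$ be $\mathfrak{sl}_2$ triads on $\mathbb{R}^n$ and $\mathbb{R}^m$, with independent variables $\mathbf{x}$ and $\mathbf{y}$. Let $\alpha$ and $\beta$ be Hilbert bases of their invariants, and let $\acute A\subset\mathbb{N}^p$ and $\grave A\subset\mathbb{N}^q$ be standard preferred sets with respect to $\alpha$ and $\beta$. For polynomial weight invariants $f$ of the first triad and $g$ of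 the second, and for $0\le s\le\min(\widehat f,\widehat g)$, the external transvectant is $$(f,g)^{(s)}=\sum_{j=0}^{s}(-1)^j\binom sj\frac{(\widehat f-j)!}{(\widehat f-s)!}\,\frac{(\widehat g-s+j)!}{(\widehat g-s)!}\,(\acute{\mathcal{Y}}^{\,j}f)\,(\grave{\mathcal{Y}}^{\,s-j}g)\in\mathbb{R}[\mathbf{x},\mathbf{y}].$$ Let $(X,Y,Z)$ be the direct-sum (block diagonal) triad on $\mathbb{R}^{n+m}$, and let $\mathcal{J}\subset\mathbb{R}[[\mathbf{x},\mathbf{y}]]$ be its formal invariants. **Theorem 8.4.** The pre-box product, that is, the family of all admissible external transvectants $$(\alpha^{\mathbf{k}},\beta^{\boldsymbol\ell})^{(s)},\qquad \mathbf{k}\in\acute A,\quad \boldsymbol\ell\in\grave A,\quad 0\le s\le\min(\widehat\alpha\mathbf{k},\widehat\beta\boldsymbol\ell),$$ indexed by the triples $(\mathbf{k},\boldsymbol\ell,s)$, is a vector space basis of the polynomial invariants $\mathcal{J}\cap\mathbb{R}[\mathbf{x},\mathbf{y}]$ and a formal basis of the formal invariants $\mathcal{J}$. -/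

import Mathlib

open scoped BigOperators

noncomputable section

namespace BoxProduct

/-! ### Triads of matrices -/

/-- An `sl₂` triad of real square matrices (rows and columns indexed by `σ`):
`[X, Y] = Z`, `[Z, X] = 2X`, `[Z, Y] = -2Y`.  The zero triad is allowed. -/
structure Sl2Triad (σ : Type) [Fintype σ] where
  X : Matrix σ σ ℝ
  Y : Matrix σ σ ℝ
  Z : Matrix σ σ ℝ
  comm_XY : X * Y - Y * X = Z
  comm_ZX : Z * X - X * Z = (2 : ℝ) • X
  comm_ZY : Z * Y - Y * Z = (-2 : ℝ) • Y

/-- The direct sum of two triads: block diagonal matrices, acting on the disjoint union of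
the two sets of variables. -/
def Sl2Triad.directSum {σ τ : Type} [Fintype σ] [Fintype τ]
    (T : Sl2Triad σ) (T' : Sl2Triad τ) : Sl2Triad (σ ⊕ τ) where
  X := Matrix.fromBlocks T.X 0 0 T'.X
  Y := Matrix.fromBlocks T.Y 0 0 T'.Y
  Z := Matrix.fromBlocks T.Z 0 0 T'.Z
  comm_XY := by
    simp [Matrix.fromBlocks_multiply, sub_eq_add_neg, Matrix.fromBlocks_neg,
      Matrix.fromBlocks_add, ← T.comm_XY, ← T'.comm_XY]
  comm_ZX := by
    simp only [Matrix.fromBlocks_multiply, sub_eq_add_neg, Matrix.fromBlocks_neg,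
      Matrix.fromBlocks_add, Matrix.fromBlocks_smul, ← T.comm_ZX, ← T'.comm_ZX]
    simp
  comm_ZY := by
    simp only [Matrix.fromBlocks_multiply, sub_eq_add_neg, Matrix.fromBlocks_neg,
      Matrix.fromBlocks_add, Matrix.fromBlocks_smul, ← T.comm_ZY, ← T'.comm_ZY]
    simp

/-! ### The differential operators `𝒟_A f = f'(x) A x` -/

section Operators

variable {σ : Type} [Fintype σ]

/-- `𝒟_A f = ∑ i, (∑ j, A i j x_j) ∂f/∂x_i` on polynomials. -/
def polyD (A : Matrix σ σ ℝ) :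
    Derivation ℝ (MvPolynomial σ ℝ) (MvPolynomial σ ℝ) :=
  ∑ i, (∑ j, MvPolynomial.C (A i j) * MvPolynomial.X j) • MvPolynomial.pderiv i

/-- `𝒟_A f = ∑ i, (∑ j, A i j x_j) ∂f/∂x_i` on formal power series. -/
def seriesD (A : Matrix σ σ ℝ) :
    Derivation ℝ (MvPowerSeries σ ℝ) (MvPowerSeries σ ℝ) :=
  ∑ i, (∑ j, MvPowerSeries.C (A i j) * MvPowerSeries.X j) • MvPowerSeries.pderiv ℝ i

theorem polyD_apply (A : Matrix σ σ ℝ) (f : MvPolynomial σ ℝ) :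
    polyD A f = ∑ i, (∑ j, MvPolynomial.C (A i j) * MvPolynomial.X j) *
      MvPolynomial.pderiv i f := by
  have h := map_sum (Derivation.coeFnAddMonoidHom (R := ℝ) (A := MvPolynomial σ ℝ)
    (M := MvPolynomial σ ℝ)) (fun i => (∑ j, MvPolynomial.C (A i j) * MvPolynomial.X j) •
      MvPolynomial.pderiv i) Finset.univ
  refine (congrFun h f).trans ?_
  rw [Finset.sum_apply]
  rfl

theorem seriesD_apply (A : Matrix σ σ ℝ) (f : MvPowerSeries σ ℝ) :
    seriesD A f = ∑ i, (∑ j, MvPowerSeries.C (A i j) * MvPowerSeries.X j) *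
      MvPowerSeries.pderiv ℝ i f := by
  have h := map_sum (Derivation.coeFnAddMonoidHom (R := ℝ) (A := MvPowerSeries σ ℝ)
    (M := MvPowerSeries σ ℝ)) (fun i => (∑ j, MvPowerSeries.C (A i j) * MvPowerSeries.X j) •
      MvPowerSeries.pderiv ℝ i) Finset.univ
  refine (congrFun h f).trans ?_
  rw [Finset.sum_apply]
  rfl

/-- The operator on polynomials is the restriction of the one on formal power series. -/
theorem seriesD_coe (A : Matrix σ σ ℝ) (f : MvPolynomial σ ℝ) :
    seriesD A (f : MvPowerSeries σ ℝ) = (polyD A f : MvPolynomial σ ℝ) := by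
  have hsum : ∀ g : σ → MvPolynomial σ ℝ,
      ((∑ i, g i : MvPolynomial σ ℝ) : MvPowerSeries σ ℝ)
        = ∑ i, (g i : MvPowerSeries σ ℝ) := fun g =>
    map_sum (MvPolynomial.coeToMvPowerSeries.ringHom (σ := σ) (R := ℝ)) g Finset.univ
  rw [seriesD_apply, polyD_apply]
  simp [hsum, MvPowerSeries.pderiv_coe]

/-- The operators of the triad interchange `X` and `Y`: `𝒳 = 𝒟_Y`, `𝒴 = 𝒟_X`, `𝒵 = 𝒟_Z`. -/
def Sl2Triad.opX (T : Sl2Triad σ) : MvPolynomial σ ℝ →ₗ[ℝ] MvPolynomial σ ℝ :=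
  (polyD T.Y).toLinearMap

/-- `𝒴 = 𝒟_X` on polynomials. -/
def Sl2Triad.opY (T : Sl2Triad σ) : MvPolynomial σ ℝ →ₗ[ℝ] MvPolynomial σ ℝ :=
  (polyD T.X).toLinearMap

/-- `𝒵 = 𝒟_Z` on polynomials. -/
def Sl2Triad.opZ (T : Sl2Triad σ) : MvPolynomial σ ℝ →ₗ[ℝ] MvPolynomial σ ℝ :=
  (polyD T.Z).toLinearMap

/-- The formal invariants `𝒥 = ker 𝒳 ⊆ ℝ[[x]]`, with `𝒳 = 𝒟_Y`. -/
def Sl2Triad.formalInvariants (T : Sl2Triad σ) : Submodule ℝ (MvPowerSeries σ ℝ) :=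
  LinearMap.ker (seriesD T.Y).toLinearMap

/-- The polynomial invariants `𝒥 ∩ ℝ[x]`. -/
def Sl2Triad.polyInvariants (T : Sl2Triad σ) : Submodule ℝ (MvPolynomial σ ℝ) :=
  LinearMap.ker T.opX

theorem Sl2Triad.mem_polyInvariants_iff (T : Sl2Triad σ) (f : MvPolynomial σ ℝ) :
    f ∈ T.polyInvariants ↔ (f : MvPowerSeries σ ℝ) ∈ T.formalInvariants := by
  have h : (f : MvPowerSeries σ ℝ) ∈ T.formalInvariants ↔
      seriesD T.Y (f : MvPowerSeries σ ℝ) = 0 := Iff.rfl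
  rw [h, seriesD_coe, ← MvPolynomial.coe_zero, MvPolynomial.coe_inj]
  rfl

/-- A (polynomial) weight invariant: a polynomial in `ker 𝒳` that is an eigenvector of `𝒵`
(in particular it is nonzero). -/
def Sl2Triad.IsWeightInvariant (T : Sl2Triad σ) (f : MvPolynomial σ ℝ) : Prop :=
  f ≠ 0 ∧ T.opX f = 0 ∧ ∃ w : ℝ, T.opZ f = w • f

/-- The weight of a weight invariant `f`, that is, its `𝒵`-eigenvalue, which is always a
nonnegative integer because `f` is a highest weight vector of a finite dimensional
representation of `sl₂`.  (For `f ≠ 0` the set below has at most one element.) -/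
def Sl2Triad.weight (T : Sl2Triad σ) (f : MvPolynomial σ ℝ) : ℕ :=
  sInf {w : ℕ | T.opZ f = (w : ℝ) • f}

end Operators

/-! ### Bases -/

/-- The family `v` is a vector space basis of the subspace `V`. -/
def IsVectorSpaceBasis {ι M : Type} [AddCommGroup M] [Module ℝ M]
    (v : ι → M) (V : Submodule ℝ M) : Prop :=
  LinearIndependent ℝ v ∧ Submodule.span ℝ (Set.range v) = V

/-- The formal (possibly infinite) linear combination `∑ i, c i • v i`, computed coefficient
by coefficient.  It is used only for families in which every monomial occurs in finitely
many members. -/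
def formalSum {ι σ : Type} (v : ι → MvPowerSeries σ ℝ) (c : ι → ℝ) : MvPowerSeries σ ℝ :=
  fun m => ∑ᶠ i, c i * MvPowerSeries.coeff m (v i)

/-- The family `v` is a formal vector space basis of the space `V` of formal power series: it is
countable, each monomial occurs in only finitely many `v i` (so that all countable linear
combinations make sense), and `c ↦ ∑ i, c i • v i` maps the families of real coefficients
bijectively onto `V`: every element of `V` is a countable linear combination of the `v i`,
in exactly one way. -/
structure IsFormalBasis {ι σ : Type} (v : ι → MvPowerSeries σ ℝ)
    (V : Submodule ℝ (MvPowerSeries σ ℝ)) : Prop where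
  countable : Countable ι
  locallyFinite : ∀ m : σ →₀ ℕ, {i | MvPowerSeries.coeff m (v i) ≠ 0}.Finite
  bijOn : Set.BijOn (formalSum v) Set.univ (V : Set (MvPowerSeries σ ℝ))

/-! ### Hilbert bases and standard preferred sets -/

section Preferred

variable {σ : Type} [Fintype σ] {p : ℕ}

/-- The monomial `α^k = α₁^k₁ ⋯ α_p^k_p`, a polynomial in `x`. -/
def monomialIn (α : Fin p → MvPolynomial σ ℝ) (k : Fin p →₀ ℕ) : MvPolynomial σ ℝ :=
  ∏ i, α i ^ k i

/-- The weight `α̂ k = α̂₁ k₁ + ⋯ + α̂_p k_p` of `α^k`. -/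
def monomialWeight (T : Sl2Triad σ) (α : Fin p → MvPolynomial σ ℝ) (k : Fin p →₀ ℕ) : ℕ :=
  ∑ i, T.weight (α i) * k i

/-- A Hilbert basis of the invariants of a triad: finitely many homogeneous weight invariants
such that every polynomial invariant is a polynomial in them. -/
structure IsHilbertBasis (T : Sl2Triad σ) (α : Fin p → MvPolynomial σ ℝ) : Prop where
  weightInvariant : ∀ i, T.IsWeightInvariant (α i)
  homogeneous : ∀ i, ∃ d : ℕ, (α i).IsHomogeneous d
  generates : ∀ f ∈ T.polyInvariants,
    ∃ P : MvPolynomial (Fin p) ℝ, MvPolynomial.aeval α P = f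

/-- A set of exponent vectors is standard if it consists of the exponents of the monomials that
do not lie in some monomial ideal of `ℝ[t₁, …, t_p]`. -/
def IsStandardSet (A : Set (Fin p →₀ ℕ)) : Prop :=
  ∃ S : Set (Fin p →₀ ℕ),
    A = {k | MvPolynomial.monomial k (1 : ℝ) ∉
      Ideal.span ((fun s => MvPolynomial.monomial s (1 : ℝ)) '' S)}

/-- A standard preferred set of monomials in the Hilbert basis `α`, given by its exponent
vectors: a standard set `A` such that the `α^k`, `k ∈ A`, form a formal vector space basis of
the formal invariants. -/
structure IsStandardPreferredSet (T : Sl2Triad σ) (α : Fin p → MvPolynomial σ ℝ)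
    (A : Set (Fin p →₀ ℕ)) : Prop where
  standard : IsStandardSet A
  formalBasis : IsFormalBasis
    (fun k : A => (monomialIn α k.1 : MvPowerSeries σ ℝ)) T.formalInvariants

end Preferred

/-! ### External transvectants and the pre-box product -/

section Transvectants

variable {σ τ : Type} [Fintype σ] [Fintype τ]

/-- The coefficient `W^{sj} = (s choose j) ((a - j)! / (a - s)!) ((b - s + j)! / (b - s)!)`
for weights `a`, `b`; used for `j ≤ s ≤ min a b`. -/
def transvectantCoeff (a b s j : ℕ) : ℝ :=
  (s.choose j : ℝ) * (((a - j).factorial : ℝ) / ((a - s).factorial : ℝ))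
    * (((b - s + j).factorial : ℝ) / ((b - s).factorial : ℝ))

/-- The external transvectant
`(f, g)^(s) = ∑_{j = 0}^s (-1)^j W^{sj} (𝒴^j f) (𝒴'^(s - j) g)`, an element of `ℝ[x, y]`;
used for `s` at most the weights of `f` and `g`. -/
def transvectant (T : Sl2Triad σ) (T' : Sl2Triad τ)
    (f : MvPolynomial σ ℝ) (g : MvPolynomial τ ℝ) (s : ℕ) : MvPolynomial (σ ⊕ τ) ℝ :=
  ∑ j ∈ Finset.range (s + 1),
    ((-1 : ℝ) ^ j * transvectantCoeff (T.weight f) (T'.weight g) s j) •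
      (MvPolynomial.rename Sum.inl ((T.opY ^ j) f) *
        MvPolynomial.rename Sum.inr ((T'.opY ^ (s - j)) g))

variable {p q : ℕ}

/-- The triples `(k, ℓ, s)` that give admissible transvectants. -/
def admissible (T : Sl2Triad σ) (T' : Sl2Triad τ)
    (α : Fin p → MvPolynomial σ ℝ) (β : Fin q → MvPolynomial τ ℝ)
    (A : Set (Fin p →₀ ℕ)) (B : Set (Fin q →₀ ℕ)) :
    Set ((Fin p →₀ ℕ) × (Fin q →₀ ℕ) × ℕ) :=
  {h | h.1 ∈ A ∧ h.2.1 ∈ B ∧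
    h.2.2 ≤ monomialWeight T α h.1 ∧ h.2.2 ≤ monomialWeight T' β h.2.1}

/-- The pre-box product: the family of all admissible external transvectants
`(α^k, β^ℓ)^(s)`, indexed by the admissible triples `(k, ℓ, s)`. -/
def preBox (T : Sl2Triad σ) (T' : Sl2Triad τ)
    (α : Fin p → MvPolynomial σ ℝ) (β : Fin q → MvPolynomial τ ℝ)
    (A : Set (Fin p →₀ ℕ)) (B : Set (Fin q →₀ ℕ)) :
    admissible T T' α β A B → MvPolynomial (σ ⊕ τ) ℝ :=
  fun h => transvectant T T' (monomialIn α h.1.1) (monomialIn β h.1.2.1) h.1.2.2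

end Transvectants

end BoxProduct

end

/-!
The argument is the Clebsch–Gordan decomposition, restricted to highest weight vectors so that
complete reducibility of `ℝ[x]` is never needed.

Let `𝒳₁` and `𝒳₂` be the raising operators of the two triads, acting on `ℝ[x, y]` with trivial action
on the other variables; they commute, and the invariants of the direct sum are `ker (𝒳₁ + 𝒳₂)`.  The
products `α^k β^ℓ` form a basis of `ker 𝒳₁ ∩ ker 𝒳₂`, because `ℝ[x, y] = ℝ[x] ⊗ ℝ[y]`.  If `h` is
invariant and `𝒳₁ ^ (N + 1) h = 0`, then `𝒳₁ ^ N h = ± 𝒳₂ ^ N h` lies in `ker 𝒳₁ ∩ ker 𝒳₂`; it is the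
leading term of `h`.  The transvectant `(α^k, β^ℓ)^(s)` is invariant with `N = s`, and its leading
term is a nonzero multiple of `α^k β^ℓ`.  So the transvectants are independent
(`linearIndependent_of_leading`), and they span by induction on `N`
(`ker_add_le_span_of_leading`), provided that a leading term `𝒳₁ ^ N h` only involves products
`α^k β^ℓ` for which both weights are at least `N`.  This is `IsSl2Rep.le_weight_of_pow_X`, applied to
`𝒳₁` and to `𝒳₂`; it uses only that the lowering operators are locally nilpotent, which holds because
the matrices `X` of the triads are nilpotent.

The passage between formal bases and vector space bases is a matter of degrees: a family of
homogeneous polynomials is a vector space basis of the polynomial invariants if and only if it is a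
formal basis of the formal invariants (`IsFormalBasis.isVectorSpaceBasis`,
`IsVectorSpaceBasis.isFormalBasis`), since the operators preserve degrees and every degree only has
finitely many monomials.
-/

noncomputable section

namespace BoxProduct

/-! ### Representations of `sl₂` by three operators -/

/-- The operators `X`, `Y`, `Z` on `V` satisfy the commutation relations of `sl₂`, where `X` raises
and `Y` lowers the `Z`-eigenvalue by `2`.  Mathlib's `IsSl2Triple` excludes the zero representation,
which is allowed here. -/
structure IsSl2Rep {V : Type*} [AddCommGroup V] [Module ℝ V] (X Y Z : Module.End ℝ V) : Prop where
  comm_XY : ∀ v, X (Y v) = Y (X v) + Z v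
  comm_ZX : ∀ v, Z (X v) = X (Z v) + (2 : ℝ) • X v
  comm_ZY : ∀ v, Z (Y v) = Y (Z v) - (2 : ℝ) • Y v

section Rep

variable {V : Type*} [AddCommGroup V] [Module ℝ V] {X Y Z : Module.End ℝ V}

theorem IsSl2Rep.Z_pow_Y (h : IsSl2Rep X Y Z) (n : ℕ) (v : V) :
    Z ((Y ^ n) v) = (Y ^ n) (Z v) - (2 * n : ℝ) • (Y ^ n) v := by
  induction n generalizing v with
  | zero => simp
  | succ n ih =>
    rw [pow_succ, Module.End.mul_apply, Module.End.mul_apply, ih, h.comm_ZY, map_sub, map_smul]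
    push_cast
    module

theorem IsSl2Rep.pow_X_Y (h : IsSl2Rep X Y Z) (n : ℕ) (v : V) :
    (X ^ (n + 1)) (Y v) =
      Y ((X ^ (n + 1)) v) + (n + 1 : ℝ) • (Z ((X ^ n) v) - (n : ℝ) • (X ^ n) v) := by
  induction n with
  | zero => simp [h.comm_XY]
  | succ n ih =>
    rw [pow_succ', Module.End.mul_apply, ih, map_add, map_smul, map_sub, map_smul, h.comm_XY,
      ← Module.End.mul_apply X, ← pow_succ']
    have h1 : X (Z ((X ^ n) v)) = Z ((X ^ (n + 1)) v) - (2 : ℝ) • (X ^ (n + 1)) v := by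
      rw [pow_succ', Module.End.mul_apply, h.comm_ZX]
      abel
    have h2 : X ((X ^ n) v) = (X ^ (n + 1)) v := by rw [pow_succ', Module.End.mul_apply]
    rw [h1, h2]
    push_cast
    module

theorem IsSl2Rep.X_pow_Y (h : IsSl2Rep X Y Z) {f : V} {w : ℝ} (hX : X f = 0) (hZ : Z f = w • f)
    (n : ℕ) : X ((Y ^ (n + 1)) f) = ((n + 1) * (w - n) : ℝ) • (Y ^ n) f := by
  induction n with
  | zero => simp [h.comm_XY, hX, hZ]
  | succ n ih =>
    rw [pow_succ', Module.End.mul_apply, h.comm_XY, ih, h.Z_pow_Y, hZ, map_smul, map_smul,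
      ← Module.End.mul_apply, ← pow_succ']
    push_cast
    module

/-- The weight of a highest weight vector is a natural number: if `Y ^ (n + 1)` is the first power
of `Y` that kills it, then the weight is `n`. -/
theorem IsSl2Rep.exists_nat_weight (h : IsSl2Rep X Y Z) {f : V} {w : ℝ} (hf : f ≠ 0) (hX : X f = 0)
    (hZ : Z f = w • f) (hY : ∃ M, (Y ^ M) f = 0) : ∃ n : ℕ, w = n := by
  classical
  obtain ⟨n, hn⟩ : ∃ n, Nat.find hY = n + 1 := by
    refine Nat.exists_eq_succ_of_ne_zero fun h0 => hf ?_
    simpa [h0] using Nat.find_spec hY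
  have h1 : (Y ^ n) f ≠ 0 := Nat.find_min hY (by omega)
  have h2 := h.X_pow_Y hX hZ n
  rw [← hn, Nat.find_spec hY, map_zero, eq_comm, smul_eq_zero, or_iff_left h1, mul_eq_zero] at h2
  refine ⟨n, ?_⟩
  rcases h2 with h2 | h2
  · exact absurd h2 (by positivity)
  · linarith

/-- The `n`-th power of the raising operator takes `Y ^ n f` back to a multiple of the highest
weight vector `f`, and the multiple is nonzero as long as `n` does not exceed the weight. -/
theorem IsSl2Rep.exists_pow_X_pow_Y (h : IsSl2Rep X Y Z) {f : V} {w n : ℕ} (hX : X f = 0)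
    (hZ : Z f = (w : ℝ) • f) (hn : n ≤ w) :
    ∃ κ : ℝ, κ ≠ 0 ∧ (X ^ n) ((Y ^ n) f) = κ • f := by
  induction n with
  | zero => exact ⟨1, one_ne_zero, by simp⟩
  | succ n ih =>
    obtain ⟨κ, hκ, e⟩ := ih (by omega)
    refine ⟨(n + 1) * (w - n) * κ, mul_ne_zero (mul_ne_zero (by positivity) ?_) hκ, ?_⟩
    · exact sub_ne_zero.2 (by exact_mod_cast (by omega : w ≠ n))
    · rw [pow_succ X, Module.End.mul_apply, h.X_pow_Y hX hZ, map_smul, e, smul_smul]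

theorem IsSl2Rep.pow_X_pow_Y_eq_zero (h : IsSl2Rep X Y Z) {f : V} {w : ℝ} {j n : ℕ} (hX : X f = 0)
    (hZ : Z f = w • f) (hj : j < n) : (X ^ n) ((Y ^ j) f) = 0 := by
  obtain ⟨n, rfl⟩ := Nat.exists_eq_succ_of_ne_zero (by omega : n ≠ 0)
  induction j generalizing n with
  | zero => simp [pow_succ, hX]
  | succ j ih =>
    obtain ⟨n, rfl⟩ := Nat.exists_eq_succ_of_ne_zero (by omega : n ≠ 0)
    rw [pow_succ X, Module.End.mul_apply, h.X_pow_Y hX hZ, map_smul, ih n (by omega), smul_zero]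

/-- A highest weight vector in the image of `X ^ N` only involves weights `≥ N`, provided that `Y`
is nilpotent on the preimage.  This replaces complete reducibility: if `X ^ N v = u` with `X u = 0`,
then `X ^ (N + 1) (Y v) = (N + 1) (Z - N) u`, so passing from `v` to `Y v` only loses weight `N`
and raises `N` by one, until `Y` has killed `v`. -/
theorem IsSl2Rep.le_weight_of_pow_X (h : IsSl2Rep X Y Z) {ι : Type*} {e : ι → V}
    (he : LinearIndependent ℝ e) (hX : ∀ i, X (e i) = 0) {w : ι → ℕ}
    (hZ : ∀ i, Z (e i) = (w i : ℝ) • e i) {M N : ℕ} {v : V} (hM : (Y ^ M) v = 0) {s : Finset ι}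
    {c : ι → ℝ} (hv : (X ^ N) v = ∑ i ∈ s, c i • e i) {i : ι} (hi : i ∈ s) (hc : c i ≠ 0) :
    N ≤ w i := by
  induction M generalizing N v c with
  | zero =>
    rw [show v = 0 by simpa using hM, map_zero] at hv
    exact absurd (linearIndependent_iff'.1 he s c hv.symm i hi) hc
  | succ M ih =>
    by_cases hN : w i = N
    · exact hN.ge
    have hM' : (Y ^ M) (Y v) = 0 := by rwa [pow_succ, Module.End.mul_apply] at hM
    have hX' : (X ^ (N + 1)) v = 0 := by
      rw [pow_succ', Module.End.mul_apply, hv, map_sum]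
      exact Finset.sum_eq_zero fun j _ => by rw [map_smul, hX, smul_zero]
    have hv' : (X ^ (N + 1)) (Y v) = ∑ j ∈ s, ((N + 1) * (w j - N) * c j : ℝ) • e j := by
      rw [h.pow_X_Y, hX', hv, map_zero, zero_add, map_sum, Finset.smul_sum,
        ← Finset.sum_sub_distrib, Finset.smul_sum]
      refine Finset.sum_congr rfl fun j _ => ?_
      rw [map_smul, hZ]
      module
    have := ih hM' hv' (mul_ne_zero (mul_ne_zero (by positivity)
      (sub_ne_zero.2 (by exact_mod_cast hN))) hc)
    omega

end Rep

/-! ### The common kernel of two commuting operators and the kernel of their sum -/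

section Kernel

variable {V : Type*} [AddCommGroup V] [Module ℝ V] {X₁ X₂ : Module.End ℝ V} {ι : Type*}
  {e : ι → V} {b : ι → ℕ} {t : {h : ι × ℕ // h.2 ≤ b h.1} → V} {κ : {h : ι × ℕ // h.2 ≤ b h.1} → ℝ}

/-- Vectors `t (i, s)` with "leading terms" `X₁ ^ s (t (i, s)) = κ • e i` are independent if the
`e i` are: apply `X₁ ^ N` for the largest `N` that occurs in a relation. -/
theorem linearIndependent_of_leading (he : LinearIndependent ℝ e) (hX₁ : ∀ i, X₁ (e i) = 0)
    (hκ : ∀ h, κ h ≠ 0) (ht : ∀ h, (X₁ ^ h.1.2) (t h) = κ h • e h.1.1) :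
    LinearIndependent ℝ t := by
  classical
  rw [linearIndependent_iff']
  intro s g hg
  by_contra! hne
  obtain ⟨h₀, hs₀, hg₀⟩ := hne
  obtain ⟨h, hm, hmax⟩ := (s.filter fun h => g h ≠ 0).exists_max_image (fun h => h.1.2)
    ⟨h₀, by simp [hs₀, hg₀]⟩
  rw [Finset.mem_filter] at hm
  have hz : ∀ h' : {h : ι × ℕ // h.2 ≤ b h.1}, h'.1.2 < h.1.2 → (X₁ ^ h.1.2) (t h') = 0 := by
    intro h' hlt
    obtain ⟨d, hd⟩ := Nat.exists_eq_add_of_lt hlt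
    rw [hd, show h'.1.2 + d + 1 = d + 1 + h'.1.2 by ring, pow_add, Module.End.mul_apply, ht,
      map_smul, pow_succ, Module.End.mul_apply, hX₁, map_zero, smul_zero]
  have hsum := congrArg (X₁ ^ h.1.2) hg
  rw [map_zero, map_sum] at hsum
  have hsum' : ∑ h' ∈ s.filter (fun h' => h'.1.2 = h.1.2), (g h' * κ h') • e h'.1.1 = 0 := by
    rw [← hsum, Finset.sum_filter]
    refine Finset.sum_congr rfl fun h' hs' => ?_
    rw [map_smul]
    split_ifs with hEq
    · rw [← hEq, ht, smul_smul]
    · by_cases hg' : g h' = 0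
      · rw [hg', zero_smul]
      · have := hmax h' (by simp [hs', hg'])
        rw [hz h' (by omega), smul_zero]
  let F : Finset {h : ι × ℕ // h.2 ≤ b h.1} := s.filter fun h' => h'.1.2 = h.1.2
  have hinj : Function.Injective fun x : (F : Set {h : ι × ℕ // h.2 ≤ b h.1}) => x.1.1.1 :=
    fun x y hxy => Subtype.ext (Subtype.ext (Prod.ext hxy
      ((Finset.mem_filter.1 x.2).2.trans (Finset.mem_filter.1 y.2).2.symm)))
  have hli : LinearIndepOn ℝ (fun h' : {h : ι × ℕ // h.2 ≤ b h.1} => e h'.1.1) F :=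
    he.comp _ hinj
  have := (linearIndepOn_finset_iff.1 hli) _ hsum' h (by simp [F, hm.1])
  exact mul_ne_zero hm.2 (hκ h) this

/-- Vectors `t (i, s)` in the kernel of `X₁ + X₂` with leading terms `X₁ ^ s (t (i, s)) = κ • e i`
span that kernel, if the `e i` span the common kernel of `X₁` and `X₂` and every leading term that
occurs in the kernel is a combination of available ones. -/
theorem ker_add_le_span_of_leading (hcomm : ∀ v, X₁ (X₂ v) = X₂ (X₁ v))
    (hspan : ∀ v, X₁ v = 0 → X₂ v = 0 → ∃ (s : Finset ι) (c : ι → ℝ), v = ∑ i ∈ s, c i • e i)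
    (hnil : ∀ v, ∃ N, (X₁ ^ N) v = 0)
    (hle : ∀ (N : ℕ) (v : V) (s : Finset ι) (c : ι → ℝ), (X₁ + X₂) v = 0 →
      (X₁ ^ N) v = ∑ i ∈ s, c i • e i → ∀ i ∈ s, c i ≠ 0 → N ≤ b i)
    (hker : ∀ h, (X₁ + X₂) (t h) = 0)
    (hκ : ∀ h, κ h ≠ 0) (ht : ∀ h, (X₁ ^ h.1.2) (t h) = κ h • e h.1.1) :
    LinearMap.ker (X₁ + X₂) ≤ Submodule.span ℝ (Set.range t) := by
  classical
  intro v hv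
  rw [LinearMap.mem_ker] at hv
  obtain ⟨N, hN⟩ := hnil v
  induction N generalizing v with
  | zero => rw [show v = 0 by simpa using hN]; exact zero_mem _
  | succ N ih =>
    have h2 : X₂ ((X₁ ^ N) v) = 0 := by
      have hc : Commute X₂ (X₁ ^ N) :=
        Commute.pow_right (LinearMap.ext fun v => (hcomm v).symm) N
      have h1 : X₂ ((X₁ ^ N) v) = (X₁ ^ N) (X₂ v) := LinearMap.congr_fun hc v
      have h3 : X₂ v = - X₁ v := by
        rw [LinearMap.add_apply] at hv
        exact eq_neg_of_add_eq_zero_right hv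
      rw [h1, h3, map_neg, ← Module.End.mul_apply, ← pow_succ, hN, neg_zero]
    obtain ⟨s, c, hsc⟩ := hspan _ (by rwa [← Module.End.mul_apply, ← pow_succ']) h2
    have hb := hle N v s c hv hsc
    -- The combination of the `t (i, N)` with the same leading term as `v`.
    let r : ι → V := fun i => if h : N ≤ b i then (c i / κ ⟨(i, N), h⟩) • t ⟨(i, N), h⟩ else 0
    have hr : ∀ i, r i ∈ Submodule.span ℝ (Set.range t) := by
      intro i
      dsimp only [r]
      split_ifs with h
      · exact Submodule.smul_mem _ _ (Submodule.subset_span ⟨_, rfl⟩)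
      · exact zero_mem _
    have hr0 : ∀ i, (X₁ + X₂) (r i) = 0 := by
      intro i
      dsimp only [r]
      split_ifs with h
      · rw [map_smul, hker, smul_zero]
      · exact map_zero _
    have hrN : ∀ i ∈ s, (X₁ ^ N) (r i) = c i • e i := by
      intro i hi
      dsimp only [r]
      split_ifs with h
      · have := ht ⟨(i, N), h⟩
        rw [map_smul, this, smul_smul, div_mul_cancel₀ _ (hκ _)]
      · rw [map_zero, not_not.1 fun hc => h (hb i hi hc), zero_smul]
    have hmem : v - ∑ i ∈ s, r i ∈ Submodule.span ℝ (Set.range t) := by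
      refine ih ?_ ?_
      · rw [map_sub, hv, map_sum, Finset.sum_eq_zero fun i _ => hr0 i, sub_zero]
      · rw [map_sub, map_sum, Finset.sum_congr rfl hrN, ← hsc, sub_self]
    simpa using add_mem hmem (sum_mem fun i (_ : i ∈ s) => hr i)

end Kernel

/-! ### The operators `𝒟_A` on polynomials -/

section PolyD

variable {σ τ : Type} [Fintype σ] [Fintype τ]

theorem polyD_X (A : Matrix σ σ ℝ) (i : σ) :
    polyD A (MvPolynomial.X i) = ∑ j, MvPolynomial.C (A i j) * MvPolynomial.X j := by
  classical
  rw [polyD_apply, Finset.sum_eq_single i]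
  · simp
  · intro j _ hj
    rw [MvPolynomial.pderiv_X_of_ne hj.symm, mul_zero]
  · simp

theorem polyD_C (A : Matrix σ σ ℝ) (r : ℝ) : polyD A (MvPolynomial.C r) = 0 :=
  (polyD A).map_algebraMap r

theorem polyD_add (A B : Matrix σ σ ℝ) (f : MvPolynomial σ ℝ) :
    polyD (A + B) f = polyD A f + polyD B f := by
  simp [polyD_apply, Finset.sum_add_distrib, add_mul]

theorem polyD_smul (r : ℝ) (A : Matrix σ σ ℝ) (f : MvPolynomial σ ℝ) :
    polyD (r • A) f = r • polyD A f := by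
  simp [polyD_apply, Finset.smul_sum, Finset.sum_mul, MvPolynomial.smul_eq_C_mul, mul_assoc]

theorem polyD_sub (A B : Matrix σ σ ℝ) (f : MvPolynomial σ ℝ) :
    polyD (A - B) f = polyD A f - polyD B f := by
  rw [eq_sub_iff_add_eq, ← polyD_add, sub_add_cancel]

theorem polyD_zero (f : MvPolynomial σ ℝ) : polyD (0 : Matrix σ σ ℝ) f = 0 := by
  simp [polyD_apply]

theorem polyD_polyD_X (A B : Matrix σ σ ℝ) (i : σ) :
    polyD A (polyD B (MvPolynomial.X i)) = polyD (B * A) (MvPolynomial.X i) := by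
  simp only [polyD_X, map_sum, Derivation.leibniz, polyD_C, smul_eq_mul, mul_zero, add_zero,
    Matrix.mul_apply, Finset.sum_mul, Finset.mul_sum, MvPolynomial.C_mul]
  rw [Finset.sum_comm]
  simp only [mul_assoc]

/-- `A ↦ 𝒟_A` reverses commutators. -/
theorem polyD_comm (A B : Matrix σ σ ℝ) (f : MvPolynomial σ ℝ) :
    polyD A (polyD B f) - polyD B (polyD A f) = polyD (B * A - A * B) f := by
  have : ⁅polyD A, polyD B⁆ = polyD (B * A - A * B) := by
    refine MvPolynomial.derivation_ext fun i => ?_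
    rw [Derivation.commutator_apply, polyD_polyD_X, polyD_polyD_X, polyD_sub]
  rw [← this, Derivation.commutator_apply]

theorem Sl2Triad.isSl2Rep (T : Sl2Triad σ) : IsSl2Rep T.opX T.opY T.opZ where
  comm_XY f := by
    have := polyD_comm T.Y T.X f
    rw [T.comm_XY] at this
    exact sub_eq_iff_eq_add'.1 this
  comm_ZX f := by
    have := polyD_comm T.Z T.Y f
    rw [← neg_sub (T.Z * T.Y), T.comm_ZY, neg_smul, neg_neg, polyD_smul] at this
    exact sub_eq_iff_eq_add'.1 this
  comm_ZY f := by
    have := polyD_comm T.Z T.X f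
    rw [← neg_sub (T.Z * T.X), T.comm_ZX, ← neg_smul, polyD_smul, neg_smul] at this
    rw [sub_eq_add_neg]
    exact sub_eq_iff_eq_add'.1 this

/-- A matrix that is an eigenvector of `[Z, ·]` with nonzero eigenvalue is nilpotent, because its
powers are eigenvectors with pairwise different eigenvalues. -/
theorem exists_pow_eq_zero_of_comm {Z N : Matrix σ σ ℝ} {r : ℝ} (hr : r ≠ 0)
    (h : Z * N - N * Z = r • N) [DecidableEq σ] : ∃ k, N ^ k = 0 := by
  by_contra! hne
  let φ : Module.End ℝ (Matrix σ σ ℝ) := LinearMap.mulLeft ℝ Z - LinearMap.mulRight ℝ Z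
  have hpow : ∀ k : ℕ, Z * N ^ k - N ^ k * Z = (r * k) • N ^ k := by
    intro k
    induction k with
    | zero => simp
    | succ k ih =>
      have e : Z * N ^ (k + 1) - N ^ (k + 1) * Z =
          (Z * N ^ k - N ^ k * Z) * N + N ^ k * (Z * N - N * Z) := by
        rw [pow_succ]; noncomm_ring
      rw [e, ih, h, smul_mul_assoc, mul_smul_comm, ← pow_succ, ← add_smul]
      push_cast
      ring_nf
  have hli := φ.eigenvectors_linearIndependent' (fun k : ℕ => r * k)
    (fun a b hab => by simpa [hr] using hab) (fun k => N ^ k)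
    (fun k => ⟨Module.End.mem_eigenspace_iff.2 (hpow k), hne k⟩)
  have := hli.finite
  exact not_finite ℕ

/-- If a derivation is nilpotent on the variables, then it is locally nilpotent. -/
theorem exists_pow_derivation_eq_zero {σ : Type}
    (D : Derivation ℝ (MvPolynomial σ ℝ) (MvPolynomial σ ℝ))
    (hX : ∀ i, ∃ k, ((D.toLinearMap : Module.End ℝ (MvPolynomial σ ℝ)) ^ k) (MvPolynomial.X i) = 0)
    (f : MvPolynomial σ ℝ) : ∃ k, ((D.toLinearMap : Module.End ℝ (MvPolynomial σ ℝ)) ^ k) f = 0 := by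
  set E : Module.End ℝ (MvPolynomial σ ℝ) := D.toLinearMap
  have hmono : ∀ {k l : ℕ} {f}, k ≤ l → (E ^ k) f = 0 → (E ^ l) f = 0 := by
    intro k l f hkl hk
    obtain ⟨d, rfl⟩ := Nat.exists_eq_add_of_le' hkl
    rw [pow_add, Module.End.mul_apply, hk, map_zero]
  have hmul : ∀ (n a b : ℕ) (f g : MvPolynomial σ ℝ), a + b = n → (E ^ a) f = 0 →
      (E ^ b) g = 0 → (E ^ n) (f * g) = 0 := by
    intro n
    induction n with
    | zero =>
      intro a b f g hab hf _
      obtain rfl : a = 0 := by omega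
      simp [show f = 0 by simpa using hf]
    | succ n ih =>
      intro a b f g hab hf hg
      have e : E (f * g) = f * E g + E f * g := by
        change D (f * g) = f * D g + D f * g
        rw [D.leibniz, smul_eq_mul, smul_eq_mul, mul_comm g]
      rw [pow_succ, Module.End.mul_apply, e, map_add]
      rcases a with _ | a
      · simp [show f = 0 by simpa using hf]
      rcases b with _ | b
      · simp [show g = 0 by simpa using hg]
      rw [ih (a + 1) b f (E g) (by omega) hf (by rwa [pow_succ, Module.End.mul_apply] at hg),
        ih a (b + 1) (E f) g (by omega) (by rwa [pow_succ, Module.End.mul_apply] at hf) hg,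
        add_zero]
  induction f using MvPolynomial.induction_on with
  | C r => exact ⟨1, by rw [pow_one]; exact D.map_algebraMap r⟩
  | add p q hp hq =>
    obtain ⟨k, hk⟩ := hp
    obtain ⟨l, hl⟩ := hq
    exact ⟨max k l, by
      rw [map_add, hmono (le_max_left k l) hk, hmono (le_max_right k l) hl, add_zero]⟩
  | mul_X p i hp =>
    obtain ⟨k, hk⟩ := hp
    obtain ⟨l, hl⟩ := hX i
    exact ⟨k + l, hmul _ k l _ _ rfl hk hl⟩

theorem exists_pow_polyD_eq_zero {Z N : Matrix σ σ ℝ} {r : ℝ} (hr : r ≠ 0)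
    (h : Z * N - N * Z = r • N) (f : MvPolynomial σ ℝ) :
    ∃ k, ((polyD N).toLinearMap ^ k : Module.End ℝ (MvPolynomial σ ℝ)) f = 0 := by
  classical
  obtain ⟨k, hk⟩ := exists_pow_eq_zero_of_comm hr h
  refine exists_pow_derivation_eq_zero (polyD N) (fun i => ⟨k, ?_⟩) f
  have : ∀ k : ℕ, (((polyD N).toLinearMap : Module.End ℝ (MvPolynomial σ ℝ)) ^ (k + 1)) (MvPolynomial.X i) =
      polyD (N ^ (k + 1)) (MvPolynomial.X i) := by
    intro k
    induction k with
    | zero => simp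
    | succ k ih =>
      rw [pow_succ', Module.End.mul_apply, ih]
      exact (polyD_polyD_X _ _ i).trans (by rw [← pow_succ])
  rcases k with _ | k
  -- `N ^ 0 = 0` only happens for matrices without rows.
  · have : IsEmpty σ := by
      by_contra hσ
      rw [not_isEmpty_iff] at hσ
      simp at hk
    exact this.elim i
  · rw [this, hk, polyD_zero]

theorem Sl2Triad.exists_pow_opX_eq_zero (T : Sl2Triad σ) (f : MvPolynomial σ ℝ) :
    ∃ k, ((T.opX : Module.End ℝ (MvPolynomial σ ℝ)) ^ k) f = 0 :=
  exists_pow_polyD_eq_zero (by norm_num) T.comm_ZY f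

theorem Sl2Triad.exists_pow_opY_eq_zero (T : Sl2Triad σ) (f : MvPolynomial σ ℝ) :
    ∃ k, ((T.opY : Module.End ℝ (MvPolynomial σ ℝ)) ^ k) f = 0 :=
  exists_pow_polyD_eq_zero (by norm_num) T.comm_ZX f

theorem isHomogeneous_polyD (A : Matrix σ σ ℝ) {f : MvPolynomial σ ℝ} {d : ℕ}
    (hf : f.IsHomogeneous d) : (polyD A f).IsHomogeneous d := by
  rw [polyD_apply]
  rcases d with _ | d
  · rw [← MvPolynomial.totalDegree_zero_iff_isHomogeneous,
      MvPolynomial.totalDegree_eq_zero_iff_eq_C] at hf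
    rw [hf]
    simpa using MvPolynomial.isHomogeneous_zero σ ℝ 0
  · refine MvPolynomial.IsHomogeneous.sum _ _ _ fun i _ => ?_
    rw [add_comm]
    refine MvPolynomial.IsHomogeneous.mul (.sum _ _ _ fun j _ => ?_) hf.pderiv
    exact MvPolynomial.isHomogeneous_C_mul_X _ _

/-! ### Weights of invariants -/

theorem Sl2Triad.IsWeightInvariant.opZ_eq {T : Sl2Triad σ} {f : MvPolynomial σ ℝ}
    (hf : T.IsWeightInvariant f) : T.opZ f = (T.weight f : ℝ) • f := by
  obtain ⟨h0, hX, w, hw⟩ := hf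
  obtain ⟨n, rfl⟩ := T.isSl2Rep.exists_nat_weight h0 hX hw (T.exists_pow_opY_eq_zero f)
  exact Nat.sInf_mem (s := {w : ℕ | T.opZ f = (w : ℝ) • f}) ⟨n, hw⟩

theorem Sl2Triad.weight_eq {T : Sl2Triad σ} {f : MvPolynomial σ ℝ} (hf : f ≠ 0) {w : ℕ}
    (hw : T.opZ f = (w : ℝ) • f) : T.weight f = w := by
  have h := Nat.sInf_mem (s := {w : ℕ | T.opZ f = (w : ℝ) • f}) ⟨w, hw⟩
  have h' : (T.weight f : ℝ) • f = (w : ℝ) • f := h.symm.trans hw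
  exact_mod_cast smul_left_injective ℝ hf h'

variable {p : ℕ}

theorem opZ_prod (T : Sl2Triad σ) {ι : Type*} (s : Finset ι)
    (f : ι → MvPolynomial σ ℝ) (w : ι → ℝ) (hf : ∀ i ∈ s, T.opZ (f i) = w i • f i) :
    T.opZ (∏ i ∈ s, f i) = (∑ i ∈ s, w i) • ∏ i ∈ s, f i := by
  classical
  induction s using Finset.induction_on with
  | empty => rw [Finset.prod_empty, Finset.sum_empty, zero_smul]; exact (polyD T.Z).map_one_eq_zero
  | insert a s ha ih =>
    rw [Finset.prod_insert ha, Finset.sum_insert ha]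
    refine ((polyD T.Z).leibniz _ _).trans ?_
    have h1 : polyD T.Z (f a) = w a • f a := hf a (by simp)
    have h2 : polyD T.Z (∏ i ∈ s, f i) = _ := ih fun i hi => hf i (by simp [hi])
    rw [h1, h2, smul_eq_mul, smul_eq_mul, add_smul, mul_smul_comm, mul_smul_comm,
      mul_comm _ (f a), add_comm]

theorem monomialIn_eq_prod {σ : Type} (α : Fin p → MvPolynomial σ ℝ) (k : Fin p →₀ ℕ) :
    monomialIn α k = ∏ i, ∏ _j ∈ Finset.range (k i), α i := by
  simp [monomialIn]

theorem IsHilbertBasis.opZ_monomialIn {T : Sl2Triad σ} {α : Fin p → MvPolynomial σ ℝ}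
    (hα : IsHilbertBasis T α) (k : Fin p →₀ ℕ) :
    T.opZ (monomialIn α k) = (monomialWeight T α k : ℝ) • monomialIn α k := by
  rw [monomialIn_eq_prod, opZ_prod T _ _ _ fun i _ => opZ_prod T _ _ _ fun _ _ =>
    (hα.weightInvariant i).opZ_eq]
  simp [monomialWeight, mul_comm]

theorem IsHilbertBasis.monomialIn_ne_zero {T : Sl2Triad σ} {α : Fin p → MvPolynomial σ ℝ}
    (hα : IsHilbertBasis T α) (k : Fin p →₀ ℕ) : monomialIn α k ≠ 0 :=
  Finset.prod_ne_zero_iff.2 fun i _ => pow_ne_zero _ (hα.weightInvariant i).1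

theorem IsHilbertBasis.weight_monomialIn {T : Sl2Triad σ} {α : Fin p → MvPolynomial σ ℝ}
    (hα : IsHilbertBasis T α) (k : Fin p →₀ ℕ) :
    T.weight (monomialIn α k) = monomialWeight T α k :=
  Sl2Triad.weight_eq (hα.monomialIn_ne_zero k) (hα.opZ_monomialIn k)

theorem IsHilbertBasis.exists_isHomogeneous_monomialIn {T : Sl2Triad σ}
    {α : Fin p → MvPolynomial σ ℝ} (hα : IsHilbertBasis T α) (k : Fin p →₀ ℕ) :
    ∃ d, (monomialIn α k).IsHomogeneous d := by
  choose d hd using hα.homogeneous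
  exact ⟨_, MvPolynomial.IsHomogeneous.prod _ _ _ fun i _ => (hd i).pow (k i)⟩

end PolyD

/-! ### Homogeneous parts of formal power series -/

section Formal

variable {σ : Type} [Fintype σ]

/-- The homogeneous part of degree `n` of a formal power series, as a polynomial. -/
def homPart (n : ℕ) : MvPowerSeries σ ℝ →ₗ[ℝ] MvPolynomial σ ℝ :=
  MvPolynomial.homogeneousComponent n ∘ₗ MvPowerSeries.truncTotal (n + 1)

theorem coeff_homPart (n : ℕ) (f : MvPowerSeries σ ℝ) (m : σ →₀ ℕ) :
    MvPolynomial.coeff m (homPart n f) = if m.degree = n then MvPowerSeries.coeff m f else 0 := by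
  rw [homPart, LinearMap.comp_apply, MvPolynomial.coeff_homogeneousComponent,
    MvPowerSeries.coeff_truncTotal_eq_ite]
  split_ifs with h1 h2
  · rfl
  · omega
  · rfl

theorem isHomogeneous_homPart (n : ℕ) (f : MvPowerSeries σ ℝ) : (homPart n f).IsHomogeneous n :=
  MvPolynomial.homogeneousComponent_isHomogeneous _ _

theorem homPart_coe (n : ℕ) (f : MvPolynomial σ ℝ) :
    homPart n (f : MvPowerSeries σ ℝ) = MvPolynomial.homogeneousComponent n f := by
  ext m
  rw [coeff_homPart, MvPolynomial.coeff_homogeneousComponent, MvPolynomial.coeff_coe]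

theorem ext_homPart {f g : MvPowerSeries σ ℝ} (h : ∀ n, homPart n f = homPart n g) : f = g := by
  ext m
  have := congrArg (MvPolynomial.coeff m) (h m.degree)
  rwa [coeff_homPart, coeff_homPart, if_pos rfl, if_pos rfl] at this

/-- `𝒟_A` preserves degrees, so the coefficients of `𝒟_A f` of a given degree only depend on those
of `f` of the same degree. -/
theorem coeff_seriesD_eq_zero (A : Matrix σ σ ℝ) {f : MvPowerSeries σ ℝ} {m : σ →₀ ℕ}
    (h : ∀ m' : σ →₀ ℕ, m'.degree = m.degree → MvPowerSeries.coeff m' f = 0) :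
    MvPowerSeries.coeff m (seriesD A f) = 0 := by
  classical
  rw [seriesD_apply, map_sum]
  refine Finset.sum_eq_zero fun i _ => ?_
  rw [MvPowerSeries.coeff_mul]
  refine Finset.sum_eq_zero fun a ha => ?_
  have ha := Finset.HasAntidiagonal.mem_antidiagonal.1 ha
  by_cases h1 : a.1.degree = 1
  · rw [MvPowerSeries.coeff_pderiv, h, zero_mul, mul_zero]
    rw [← ha, map_add, map_add, h1, Finsupp.degree_single, add_comm]
  · rw [map_sum, Finset.sum_eq_zero, zero_mul]
    intro j _
    rw [MvPowerSeries.coeff_C_mul, MvPowerSeries.coeff_X, if_neg, mul_zero]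
    rintro h2
    exact h1 (by rw [h2, Finsupp.degree_single])

theorem homPart_seriesD (A : Matrix σ σ ℝ) (f : MvPowerSeries σ ℝ) (n : ℕ) :
    homPart n (seriesD A f) = polyD A (homPart n f) := by
  ext m
  rw [coeff_homPart]
  split_ifs with h
  · rw [← MvPolynomial.coeff_coe, ← seriesD_coe, ← sub_eq_zero, ← map_sub, ← map_sub]
    refine coeff_seriesD_eq_zero A fun m' hm' => ?_
    rw [map_sub, MvPolynomial.coeff_coe, coeff_homPart, if_pos (hm'.trans h), sub_self]
  · exact ((isHomogeneous_polyD A (isHomogeneous_homPart n f)).coeff_eq_zero h).symm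

theorem mem_formalInvariants_iff_homPart (T : Sl2Triad σ) (f : MvPowerSeries σ ℝ) :
    f ∈ T.formalInvariants ↔ ∀ n, homPart n f ∈ T.polyInvariants := by
  have h1 : f ∈ T.formalInvariants ↔ seriesD T.Y f = 0 := Iff.rfl
  have h2 : ∀ g, g ∈ T.polyInvariants ↔ polyD T.Y g = 0 := fun g => Iff.rfl
  rw [h1]
  simp only [h2, ← homPart_seriesD]
  exact ⟨fun h n => by rw [h, map_zero], fun h => ext_homPart fun n => by rw [h, map_zero]⟩

/-! ### Vector space bases and formal bases of homogeneous polynomials -/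

variable {ι : Type} {v : ι → MvPolynomial σ ℝ} {d : ι → ℕ}

theorem homPart_formalSum (hd : ∀ i, (v i).IsHomogeneous (d i)) (hfin : ∀ n, {i | d i = n}.Finite)
    (c : ι → ℝ) (n : ℕ) :
    homPart n (formalSum (fun i => (v i : MvPowerSeries σ ℝ)) c) =
      ∑ i ∈ (hfin n).toFinset, c i • v i := by
  ext m
  rw [coeff_homPart, MvPolynomial.coeff_sum]
  split_ifs with h
  · refine (finsum_eq_sum_of_support_subset _ fun i hi => ?_).trans
      (Finset.sum_congr rfl fun i _ => by
        rw [MvPolynomial.coeff_smul, smul_eq_mul, MvPolynomial.coeff_coe])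
    rw [Set.Finite.coe_toFinset, Set.mem_ofPred_eq]
    by_contra hne
    refine hi ?_
    beta_reduce
    rw [MvPolynomial.coeff_coe, (hd i).coeff_eq_zero (by rw [h]; exact Ne.symm hne), mul_zero]
  · refine (Finset.sum_eq_zero fun i hi => ?_).symm
    rw [Set.Finite.mem_toFinset, Set.mem_ofPred_eq] at hi
    rw [MvPolynomial.coeff_smul, (hd i).coeff_eq_zero (by rwa [hi]), smul_zero]

theorem formalSum_eq_sum {σ ι : Type} (v : ι → MvPowerSeries σ ℝ) {c : ι → ℝ} (s : Finset ι)
    (hc : ∀ i ∉ s, c i = 0) : formalSum v c = ∑ i ∈ s, c i • v i := by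
  ext m
  rw [map_sum]
  refine (finsum_eq_sum_of_support_subset _ fun i hi => ?_).trans
    (Finset.sum_congr rfl fun i _ => by rw [MvPowerSeries.coeff_smul])
  by_contra hne
  exact hi (by beta_reduce; rw [hc i hne, zero_mul])

theorem coe_sum_smul {σ ι : Type} (s : Finset ι) (c : ι → ℝ) (v : ι → MvPolynomial σ ℝ) :
    ((∑ i ∈ s, c i • v i : MvPolynomial σ ℝ) : MvPowerSeries σ ℝ) =
      ∑ i ∈ s, c i • (v i : MvPowerSeries σ ℝ) := by
  ext m
  simp [MvPolynomial.coeff_coe, MvPolynomial.coeff_sum]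

theorem finite_degree_eq_of_linearIndependent (hv : LinearIndependent ℝ v)
    (hd : ∀ i, (v i).IsHomogeneous (d i)) (n : ℕ) : {i | d i = n}.Finite := by
  have hM : Module.Finite ℝ (MvPolynomial.homogeneousSubmodule σ ℝ n) :=
    Module.Finite.iff_fg.2 (MvPolynomial.homogeneousSubmodule_fg σ ℝ n)
  let u : {i | d i = n} → MvPolynomial.homogeneousSubmodule σ ℝ n :=
    fun i => ⟨v i, by have h : d i = n := i.2; have := hd i; rwa [h] at this⟩
  have hu : LinearIndependent ℝ u :=
    LinearIndependent.of_comp (MvPolynomial.homogeneousSubmodule σ ℝ n).subtype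
      (hv.comp _ Subtype.val_injective)
  exact hu.finite

/-- A vector space basis of the polynomial invariants that consists of homogeneous polynomials is a
formal basis of the formal invariants. -/
theorem IsVectorSpaceBasis.isFormalBasis {T : Sl2Triad σ} (hd : ∀ i, (v i).IsHomogeneous (d i))
    (hv : IsVectorSpaceBasis v T.polyInvariants) :
    IsFormalBasis (fun i => (v i : MvPowerSeries σ ℝ)) T.formalInvariants := by
  classical
  obtain ⟨hli, hspan⟩ := hv
  have hfin := finite_degree_eq_of_linearIndependent hli hd
  refine ⟨?_, fun m => (hfin m.degree).subset fun i hi => ?_, ?_, ?_, ?_⟩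
  · have h : (Set.univ : Set ι).Countable := by
      refine (Set.countable_iUnion fun n => (hfin n).countable).mono
        fun i _ => Set.mem_iUnion.2 ⟨d i, ?_⟩
      exact rfl
    exact Set.countable_univ_iff.1 h
  · by_contra hne
    exact hi (by rw [MvPolynomial.coeff_coe, (hd i).coeff_eq_zero (Ne.symm hne)])
  · intro c _
    refine (mem_formalInvariants_iff_homPart T _).2 fun n => ?_
    rw [homPart_formalSum hd hfin, ← hspan]
    exact sum_mem fun i _ => Submodule.smul_mem _ _ (Submodule.subset_span ⟨i, rfl⟩)
  · intro c _ c' _ h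
    funext i
    have h1 := congrArg (homPart (d i)) h
    rw [homPart_formalSum hd hfin, homPart_formalSum hd hfin, ← sub_eq_zero,
      ← Finset.sum_sub_distrib] at h1
    simp only [← sub_smul] at h1
    exact sub_eq_zero.1 (linearIndependent_iff'.1 hli _ (fun i => c i - c' i) h1 i (by simp))
  · intro f hf
    have h : ∀ n, ∃ a : ι → ℝ, homPart n f = ∑ i ∈ (hfin n).toFinset, a i • v i := by
      intro n
      have h1 : homPart n f ∈ Submodule.span ℝ (Set.range v) :=
        hspan.symm ▸ (mem_formalInvariants_iff_homPart T f).1 hf n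
      obtain ⟨a, ha⟩ := (Finsupp.mem_span_range_iff_exists_finsupp).1 h1
      refine ⟨a, ?_⟩
      have h2 : homPart n (formalSum (fun i => (v i : MvPowerSeries σ ℝ)) a) = homPart n f := by
        rw [formalSum_eq_sum _ a.support fun i hi => Finsupp.notMem_support_iff.1 hi,
          ← coe_sum_smul, homPart_coe, show ∑ i ∈ a.support, a i • v i = homPart n f from ha]
        exact MvPolynomial.homogeneousComponent_eq_self (isHomogeneous_homPart n f)
      rw [← h2, homPart_formalSum hd hfin]
    choose a ha using h
    refine ⟨fun i => a (d i) i, Set.mem_univ _, ext_homPart fun n => ?_⟩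
    rw [homPart_formalSum hd hfin, ha]
    refine Finset.sum_congr rfl fun i hi => ?_
    rw [Set.Finite.mem_toFinset, Set.mem_ofPred_eq] at hi
    rw [hi]

/-- A formal basis of the formal invariants that consists of homogeneous polynomials is a vector
space basis of the polynomial invariants. -/
theorem IsFormalBasis.isVectorSpaceBasis {T : Sl2Triad σ} (hd : ∀ i, (v i).IsHomogeneous (d i))
    (h0 : ∀ i, v i ≠ 0)
    (hv : IsFormalBasis (fun i => (v i : MvPowerSeries σ ℝ)) T.formalInvariants) :
    IsVectorSpaceBasis v T.polyInvariants := by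
  classical
  have hfin : ∀ n, {i | d i = n}.Finite := by
    intro n
    refine ((Finsupp.finite_of_degree_eq (σ := σ) n).biUnion
      fun m _ => hv.locallyFinite m).subset fun i hi => ?_
    obtain ⟨m, hm⟩ := MvPolynomial.ne_zero_iff.1 (h0 i)
    refine Set.mem_biUnion (x := m) ?_ (by
      rw [Set.mem_ofPred_eq, MvPolynomial.coeff_coe]; exact hm)
    by_contra hne
    rw [Set.mem_ofPred_eq] at hi hne
    exact hm ((hd i).coeff_eq_zero (by rwa [hi]))
  refine ⟨linearIndependent_iff'.2 fun s g hg i hi => ?_, le_antisymm ?_ fun f hf => ?_⟩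
  · have h1 : formalSum (fun i => (v i : MvPowerSeries σ ℝ)) (fun i => if i ∈ s then g i else 0) =
        formalSum (fun i => (v i : MvPowerSeries σ ℝ)) 0 := by
      rw [formalSum_eq_sum _ s fun i hi => if_neg hi, formalSum_eq_sum _ (c := 0) s fun i _ => rfl,
        ← coe_sum_smul, ← coe_sum_smul,
        Finset.sum_congr rfl fun i hi => by rw [if_pos hi], hg]
      simp
    have h2 := congrFun (hv.bijOn.injOn (Set.mem_univ _) (Set.mem_univ _) h1) i
    simpa [hi] using h2
  · rw [Submodule.span_le]
    rintro _ ⟨i, rfl⟩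
    have h1 := hv.bijOn.mapsTo (Set.mem_univ (Pi.single i (1 : ℝ)))
    rw [formalSum_eq_sum _ {i} fun j hj => Pi.single_eq_of_ne (by simpa using hj) _] at h1
    exact (T.mem_polyInvariants_iff _).2 (by simpa using h1)
  · obtain ⟨c, -, hc⟩ := hv.bijOn.surjOn ((T.mem_polyInvariants_iff f).1 hf)
    rw [← MvPolynomial.sum_homogeneousComponent f]
    refine sum_mem fun n _ => ?_
    rw [← homPart_coe, ← hc, homPart_formalSum hd hfin]
    exact sum_mem fun i _ => Submodule.smul_mem _ _ (Submodule.subset_span ⟨i, rfl⟩)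

end Formal

/-! ### Products of polynomials in separate variables -/

section Tensor

open scoped TensorProduct

/-- Over a field, the common kernel of `φ ⊗ 1` and `1 ⊗ ψ` is `ker φ ⊗ ker ψ`; in terms of spanning
families of the two kernels. -/
theorem mem_span_tmul_of_rTensor_lTensor_eq_zero {K M N I J : Type*} [Field K] [AddCommGroup M]
    [Module K M] [AddCommGroup N] [Module K N] (φ : Module.End K M) (ψ : Module.End K N)
    {f : I → M} {g : J → N} (hf : Submodule.span K (Set.range f) = LinearMap.ker φ)
    (hg : Submodule.span K (Set.range g) = LinearMap.ker ψ) {z : M ⊗[K] N}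
    (hφ : φ.rTensor N z = 0) (hψ : ψ.lTensor M z = 0) :
    z ∈ Submodule.span K (Set.range fun h : I × J => f h.1 ⊗ₜ[K] g h.2) := by
  obtain ⟨z, rfl⟩ := (Module.Flat.rTensor_exact N (LinearMap.exact_subtype_ker_map φ) _).1 hφ
  have h1 : ψ.lTensor (LinearMap.ker φ) z = 0 := by
    have hinj := Module.Flat.rTensor_preserves_injective_linearMap (M := N)
      (LinearMap.ker φ).subtype (Submodule.subtype_injective _)
    refine hinj ?_
    rw [map_zero, ← hψ, ← LinearMap.comp_apply, ← LinearMap.comp_apply,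
      LinearMap.rTensor_comp_lTensor, LinearMap.lTensor_comp_rTensor]
  obtain ⟨z, rfl⟩ := (Module.Flat.lTensor_exact _ (LinearMap.exact_subtype_ker_map ψ) _).1 h1
  clear h1 hφ hψ
  induction z using TensorProduct.induction_on with
  | zero => simp
  | add x y hx hy => simpa only [map_add] using add_mem hx hy
  | tmul x y =>
    obtain ⟨x, hx⟩ := x
    obtain ⟨y, hy⟩ := y
    rw [← hf] at hx
    rw [← hg] at hy
    have h := Submodule.apply_mem_map₂ (TensorProduct.mk K M N) hx hy
    rw [Submodule.map₂_span_span, Set.image2_range] at h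
    exact h

variable {σ τ : Type}

/-- The product `f(x) g(y)` of polynomials in separate variables. -/
def sumProd : MvPolynomial σ ℝ →ₗ[ℝ] MvPolynomial τ ℝ →ₗ[ℝ] MvPolynomial (σ ⊕ τ) ℝ :=
  (LinearMap.mul ℝ (MvPolynomial (σ ⊕ τ) ℝ)).compl₁₂
    (MvPolynomial.rename Sum.inl).toLinearMap (MvPolynomial.rename Sum.inr).toLinearMap

theorem sumProd_apply (f : MvPolynomial σ ℝ) (g : MvPolynomial τ ℝ) :
    sumProd f g = MvPolynomial.rename Sum.inl f * MvPolynomial.rename Sum.inr g := rfl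

theorem tensorEquivSum_tmul (f : MvPolynomial σ ℝ) (g : MvPolynomial τ ℝ) :
    MvPolynomial.tensorEquivSum ℝ σ τ ℝ (f ⊗ₜ g) = sumProd f g := by
  let Φ : MvPolynomial σ ℝ ⊗[ℝ] MvPolynomial τ ℝ →ₐ[ℝ] MvPolynomial (σ ⊕ τ) ℝ :=
    (MvPolynomial.tensorEquivSum ℝ σ τ ℝ).toAlgHom
  have h1 : Φ.comp Algebra.TensorProduct.includeLeft = MvPolynomial.rename Sum.inl :=
    MvPolynomial.algHom_ext fun i => by simp [Φ]
  have h2 : Φ.comp Algebra.TensorProduct.includeRight = MvPolynomial.rename Sum.inr :=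
    MvPolynomial.algHom_ext fun i => by simp [Φ]
  rw [sumProd_apply, ← h1, ← h2]
  change Φ (f ⊗ₜ g) = Φ (f ⊗ₜ 1) * Φ (1 ⊗ₜ g)
  rw [← map_mul, Algebra.TensorProduct.tmul_mul_tmul, mul_one, one_mul]

theorem linearIndependent_sumProd {I J : Type*} {f : I → MvPolynomial σ ℝ}
    {g : J → MvPolynomial τ ℝ} (hf : LinearIndependent ℝ f) (hg : LinearIndependent ℝ g) :
    LinearIndependent ℝ fun h : I × J => sumProd (f h.1) (g h.2) := by
  have := (hf.tmul_of_isDomain hg).map' (MvPolynomial.tensorEquivSum ℝ σ τ ℝ).toLinearMap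
    (LinearMap.ker_eq_bot.2 (MvPolynomial.tensorEquivSum ℝ σ τ ℝ).injective)
  simpa only [Function.comp_def, AlgEquiv.toLinearMap_apply, tensorEquivSum_tmul] using this

variable [Fintype σ] [Fintype τ]

theorem polyD_fromBlocks_rename_inl (A : Matrix σ σ ℝ) (B : Matrix τ τ ℝ) (f : MvPolynomial σ ℝ) :
    polyD (Matrix.fromBlocks A 0 0 B) (MvPolynomial.rename Sum.inl f) =
      MvPolynomial.rename Sum.inl (polyD A f) := by
  induction f using MvPolynomial.induction_on with
  | C r => rw [polyD_C, MvPolynomial.rename_C, polyD_C, map_zero]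
  | add p q hp hq => simp only [map_add, hp, hq]
  | mul_X p i hp =>
    simp only [map_mul, Derivation.leibniz, hp, map_add, smul_eq_mul, MvPolynomial.rename_X,
      polyD_X, map_sum, MvPolynomial.rename_C, Fintype.sum_sum_type, Matrix.fromBlocks_apply₁₁,
      Matrix.fromBlocks_apply₁₂, Matrix.zero_apply, zero_mul, Finset.sum_const_zero, add_zero,
      MvPolynomial.C_0]

theorem polyD_fromBlocks_rename_inr (A : Matrix σ σ ℝ) (B : Matrix τ τ ℝ) (g : MvPolynomial τ ℝ) :
    polyD (Matrix.fromBlocks A 0 0 B) (MvPolynomial.rename Sum.inr g) =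
      MvPolynomial.rename Sum.inr (polyD B g) := by
  induction g using MvPolynomial.induction_on with
  | C r => rw [polyD_C, MvPolynomial.rename_C, polyD_C, map_zero]
  | add p q hp hq => simp only [map_add, hp, hq]
  | mul_X p i hp =>
    simp only [map_mul, Derivation.leibniz, hp, map_add, smul_eq_mul, MvPolynomial.rename_X,
      polyD_X, map_sum, MvPolynomial.rename_C, Fintype.sum_sum_type, Matrix.fromBlocks_apply₂₁,
      Matrix.fromBlocks_apply₂₂, Matrix.zero_apply, zero_mul, Finset.sum_const_zero, zero_add,
      MvPolynomial.C_0]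

theorem polyD_fromBlocks_sumProd (A : Matrix σ σ ℝ) (B : Matrix τ τ ℝ) (f : MvPolynomial σ ℝ)
    (g : MvPolynomial τ ℝ) : polyD (Matrix.fromBlocks A 0 0 B) (sumProd f g) =
      sumProd (polyD A f) g + sumProd f (polyD B g) := by
  rw [sumProd_apply, Derivation.leibniz, polyD_fromBlocks_rename_inl, polyD_fromBlocks_rename_inr,
    sumProd_apply, sumProd_apply, smul_eq_mul, smul_eq_mul]
  ring

/-- The zero triad. -/
def zeroTriad (σ : Type) [Fintype σ] : Sl2Triad σ := ⟨0, 0, 0, by simp, by simp, by simp⟩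

variable (σ τ)

/-- A triad on the first variables of `ℝ[x, y]`, acting trivially on the others. -/
def Sl2Triad.left (T : Sl2Triad σ) : Sl2Triad (σ ⊕ τ) := T.directSum (zeroTriad τ)

/-- A triad on the second variables of `ℝ[x, y]`, acting trivially on the others. -/
def Sl2Triad.right (T' : Sl2Triad τ) : Sl2Triad (σ ⊕ τ) := (zeroTriad σ).directSum T'

variable {σ τ} (T : Sl2Triad σ) (T' : Sl2Triad τ) (f : MvPolynomial σ ℝ) (g : MvPolynomial τ ℝ)

theorem Sl2Triad.opX_left_sumProd : (T.left σ τ).opX (sumProd f g) = sumProd (T.opX f) g := by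
  refine (polyD_fromBlocks_sumProd T.Y 0 f g).trans ?_
  rw [polyD_zero, map_zero, add_zero]; rfl

theorem Sl2Triad.opZ_left_sumProd : (T.left σ τ).opZ (sumProd f g) = sumProd (T.opZ f) g := by
  refine (polyD_fromBlocks_sumProd T.Z 0 f g).trans ?_
  rw [polyD_zero, map_zero, add_zero]; rfl

theorem Sl2Triad.opX_right_sumProd : (T'.right σ τ).opX (sumProd f g) = sumProd f (T'.opX g) := by
  refine (polyD_fromBlocks_sumProd 0 T'.Y f g).trans ?_
  rw [polyD_zero, map_zero, LinearMap.zero_apply, zero_add]; rfl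

theorem Sl2Triad.opZ_right_sumProd : (T'.right σ τ).opZ (sumProd f g) = sumProd f (T'.opZ g) := by
  refine (polyD_fromBlocks_sumProd 0 T'.Z f g).trans ?_
  rw [polyD_zero, map_zero, LinearMap.zero_apply, zero_add]; rfl

theorem Sl2Triad.pow_opX_left_sumProd (n : ℕ) :
    ((T.left σ τ).opX ^ n) (sumProd f g) = sumProd ((T.opX ^ n) f) g := by
  induction n with
  | zero => rfl
  | succ n ih =>
    rw [pow_succ', Module.End.mul_apply, ih, opX_left_sumProd, pow_succ', Module.End.mul_apply]

theorem Sl2Triad.opX_directSum : (T.directSum T').opX = (T.left σ τ).opX + (T'.right σ τ).opX := by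
  refine LinearMap.ext fun h => (Eq.trans ?_ (polyD_add _ _ h))
  simp [opX, left, right, directSum, zeroTriad, Matrix.fromBlocks_add]

theorem Sl2Triad.opX_left_opX_right_comm (h : MvPolynomial (σ ⊕ τ) ℝ) :
    (T.left σ τ).opX ((T'.right σ τ).opX h) = (T'.right σ τ).opX ((T.left σ τ).opX h) := by
  refine sub_eq_zero.1 ((polyD_comm _ _ h).trans ?_)
  have : (T'.right σ τ).Y * (T.left σ τ).Y - (T.left σ τ).Y * (T'.right σ τ).Y = 0 := by
    simp [left, right, directSum, zeroTriad, Matrix.fromBlocks_multiply]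
  rw [this, polyD_zero]

theorem mem_span_sumProd_of_opX_eq_zero {I J : Type*} {f : I → MvPolynomial σ ℝ}
    {g : J → MvPolynomial τ ℝ} (hf : Submodule.span ℝ (Set.range f) = T.polyInvariants)
    (hg : Submodule.span ℝ (Set.range g) = T'.polyInvariants) {h : MvPolynomial (σ ⊕ τ) ℝ}
    (hl : (T.left σ τ).opX h = 0) (hr : (T'.right σ τ).opX h = 0) :
    h ∈ Submodule.span ℝ (Set.range fun i : I × J => sumProd (f i.1) (g i.2)) := by
  let Φ : MvPolynomial σ ℝ ⊗[ℝ] MvPolynomial τ ℝ ≃ₗ[ℝ] MvPolynomial (σ ⊕ τ) ℝ :=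
    (MvPolynomial.tensorEquivSum ℝ σ τ ℝ).toLinearEquiv
  have hΦ : ∀ f g, Φ (f ⊗ₜ g) = sumProd f g := tensorEquivSum_tmul
  obtain ⟨z, rfl⟩ := Φ.surjective h
  have h1 : (T.left σ τ).opX ∘ₗ Φ.toLinearMap = Φ.toLinearMap ∘ₗ T.opX.rTensor _ :=
    TensorProduct.ext' fun f g => by simp [hΦ, Sl2Triad.opX_left_sumProd]
  have h2 : (T'.right σ τ).opX ∘ₗ Φ.toLinearMap = Φ.toLinearMap ∘ₗ T'.opX.lTensor _ :=
    TensorProduct.ext' fun f g => by simp [hΦ, Sl2Triad.opX_right_sumProd]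
  have h3 := mem_span_tmul_of_rTensor_lTensor_eq_zero T.opX T'.opX hf hg (z := z)
    (Φ.injective ((LinearMap.congr_fun h1 z).symm.trans (hl.trans (map_zero Φ).symm)))
    (Φ.injective ((LinearMap.congr_fun h2 z).symm.trans (hr.trans (map_zero Φ).symm)))
  have h4 := Submodule.mem_map_of_mem (f := Φ.toLinearMap) h3
  rw [Submodule.map_span, ← Set.range_comp] at h4
  have h5 : (⇑Φ.toLinearMap ∘ fun i : I × J => f i.1 ⊗ₜ[ℝ] g i.2) =
      fun i => sumProd (f i.1) (g i.2) := funext fun i => hΦ _ _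
  rwa [h5] at h4

end Tensor

/-! ### Transvectants -/

section TransvectantBasis

variable {σ τ : Type} [Fintype σ] [Fintype τ] {T : Sl2Triad σ} {T' : Sl2Triad τ}

theorem transvectant_eq_sum (T : Sl2Triad σ) (T' : Sl2Triad τ) (f : MvPolynomial σ ℝ)
    (g : MvPolynomial τ ℝ) (s : ℕ) : transvectant T T' f g s =
      ∑ j ∈ Finset.range (s + 1), ((-1 : ℝ) ^ j *
        transvectantCoeff (T.weight f) (T'.weight g) s j) •
          sumProd ((T.opY ^ j) f) ((T'.opY ^ (s - j)) g) := rfl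

/-- The recursion for the coefficients that makes transvectants invariant. -/
theorem transvectantCoeff_succ {a b n i : ℕ} (hi : i ≤ n) (ha : n + 1 ≤ a) (hb : n + 1 ≤ b) :
    transvectantCoeff a b (n + 1) (i + 1) * ((i + 1) * (a - i)) =
      transvectantCoeff a b (n + 1) i * (((n - i : ℕ) + 1) * (b - (n - i : ℕ))) := by
  obtain ⟨c, rfl⟩ := Nat.exists_eq_add_of_le hi
  obtain ⟨a, rfl⟩ := Nat.exists_eq_add_of_le ha
  obtain ⟨b, rfl⟩ := Nat.exists_eq_add_of_le hb
  have e1 : i + c + 1 + a - (i + 1) = c + a := by omega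
  have e2 : i + c + 1 + a - i = c + a + 1 := by omega
  have e3 : i + c + 1 + a - (i + c + 1) = a := by omega
  have e4 : i + c + 1 + b - (i + c + 1) = b := by omega
  have e5 : i + c - i = c := by omega
  have e6 : b + (i + 1) = b + i + 1 := by omega
  have h : ((i + c + 1).choose (i + 1) : ℝ) * (i + 1) = (i + c + 1).choose i * (c + 1) := by
    have := Nat.choose_succ_right_eq (i + c + 1) i
    rw [show i + c + 1 - i = c + 1 by omega] at this
    exact_mod_cast this
  simp only [transvectantCoeff, e1, e2, e3, e4, e5, e6, Nat.factorial_succ]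
  push_cast
  linear_combination ((c + a + 1 : ℝ) * ((c + a).factorial / a.factorial) *
    ((b + i + 1) * (b + i).factorial / b.factorial)) * h

theorem transvectantCoeff_pos {a b s : ℕ} (j : ℕ) (hj : j ≤ s) :
    0 < transvectantCoeff a b s j := by
  have : 0 < s.choose j := Nat.choose_pos hj
  unfold transvectantCoeff
  positivity

/-- Transvectants of highest weight vectors are invariants: the images of consecutive terms under
the raising operator telescope. -/
theorem opX_transvectant {f : MvPolynomial σ ℝ} {g : MvPolynomial τ ℝ} {s : ℕ}
    (hf : T.opX f = 0) (hfZ : T.opZ f = (T.weight f : ℝ) • f)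
    (hg : T'.opX g = 0) (hgZ : T'.opZ g = (T'.weight g : ℝ) • g)
    (hsf : s ≤ T.weight f) (hsg : s ≤ T'.weight g) :
    (T.directSum T').opX (transvectant T T' f g s) = 0 := by
  rw [transvectant_eq_sum, T.opX_directSum, LinearMap.add_apply, map_sum, map_sum]
  simp only [map_smul, Sl2Triad.opX_left_sumProd, Sl2Triad.opX_right_sumProd]
  rcases s with _ | n
  · simp [hf, hg]
  -- `j = 0` contributes nothing to the first sum and `j = s` nothing to the second; the other terms
  -- of the two sums cancel after a shift of `j` by one.
  rw [Finset.sum_range_succ', Finset.sum_range_succ (n := n + 1)]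
  simp only [pow_zero, Module.End.one_apply, hf, hg, map_zero, LinearMap.zero_apply, smul_zero,
    add_zero, Nat.sub_self]
  rw [← Finset.sum_add_distrib]
  refine Finset.sum_eq_zero fun i hi => ?_
  have hi : i ≤ n := Nat.lt_succ_iff.1 (Finset.mem_range.1 hi)
  rw [show n + 1 - i = (n - i) + 1 by omega, show n + 1 - (i + 1) = n - i by omega,
    T.isSl2Rep.X_pow_Y hf hfZ, T'.isSl2Rep.X_pow_Y hg hgZ, map_smul, LinearMap.smul_apply,
    map_smul, smul_smul, smul_smul, ← add_smul, mul_assoc, transvectantCoeff_succ hi hsf hsg]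
  rw [show ∀ x y z : ℝ, (-1) ^ (i + 1) * x + (-1) ^ i * y * z =
    (-1) ^ i * (y * z - x) by intros; ring, sub_self, mul_zero, zero_smul]

theorem exists_pow_opX_left_transvectant {f : MvPolynomial σ ℝ} {g : MvPolynomial τ ℝ} {s : ℕ}
    (hf : T.opX f = 0) (hfZ : T.opZ f = (T.weight f : ℝ) • f) (hsf : s ≤ T.weight f) :
    ∃ κ : ℝ, κ ≠ 0 ∧ ((T.left σ τ).opX ^ s) (transvectant T T' f g s) = κ • sumProd f g := by
  obtain ⟨κ, hκ, e⟩ := T.isSl2Rep.exists_pow_X_pow_Y hf hfZ hsf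
  refine ⟨(-1) ^ s * transvectantCoeff (T.weight f) (T'.weight g) s s * κ,
    mul_ne_zero (mul_ne_zero (by simp) (transvectantCoeff_pos s le_rfl).ne') hκ, ?_⟩
  rw [transvectant_eq_sum, map_sum, Finset.sum_range_succ, Finset.sum_eq_zero, zero_add, map_smul,
    Sl2Triad.pow_opX_left_sumProd, e, Nat.sub_self, pow_zero, Module.End.one_apply, map_smul,
    LinearMap.smul_apply, smul_smul]
  intro j hj
  rw [map_smul, Sl2Triad.pow_opX_left_sumProd,
    T.isSl2Rep.pow_X_pow_Y_eq_zero hf hfZ (Finset.mem_range.1 hj), map_zero,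
    LinearMap.zero_apply, smul_zero]

theorem isHomogeneous_pow_opY {f : MvPolynomial σ ℝ} {d : ℕ} (hf : f.IsHomogeneous d) (j : ℕ) :
    ((T.opY ^ j) f).IsHomogeneous d := by
  induction j with
  | zero => simpa using hf
  | succ j ih =>
    rw [pow_succ', Module.End.mul_apply]
    exact isHomogeneous_polyD T.X ih

theorem isHomogeneous_transvectant {f : MvPolynomial σ ℝ} {g : MvPolynomial τ ℝ} {d d' : ℕ}
    (hf : f.IsHomogeneous d) (hg : g.IsHomogeneous d') (s : ℕ) :
    (transvectant T T' f g s).IsHomogeneous (d + d') :=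
  MvPolynomial.IsHomogeneous.sum _ _ _ fun j _ =>
    Submodule.smul_mem (MvPolynomial.homogeneousSubmodule _ ℝ _) _
      ((isHomogeneous_pow_opY hf j).rename_isHomogeneous.mul
        (isHomogeneous_pow_opY hg (s - j)).rename_isHomogeneous)

/-- The Clebsch–Gordan decomposition for polynomial invariants: the transvectants of weight vectors
that form bases of the two spaces of invariants form a basis of the invariants of the direct sum. -/
theorem isVectorSpaceBasis_transvectant {I J : Type} {f : I → MvPolynomial σ ℝ}
    {g : J → MvPolynomial τ ℝ} (hf : IsVectorSpaceBasis f T.polyInvariants)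
    (hg : IsVectorSpaceBasis g T'.polyInvariants)
    (hfZ : ∀ i, T.opZ (f i) = (T.weight (f i) : ℝ) • f i)
    (hgZ : ∀ j, T'.opZ (g j) = (T'.weight (g j) : ℝ) • g j) :
    IsVectorSpaceBasis
      (fun h : {h : (I × J) × ℕ // h.2 ≤ min (T.weight (f h.1.1)) (T'.weight (g h.1.2))} =>
        transvectant T T' (f h.1.1.1) (g h.1.1.2) h.1.2)
      (T.directSum T').polyInvariants := by
  have hfX : ∀ i, T.opX (f i) = 0 := fun i =>
    (hf.2 ▸ Submodule.subset_span ⟨i, rfl⟩ : f i ∈ T.polyInvariants)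
  have hgX : ∀ j, T'.opX (g j) = 0 := fun j =>
    (hg.2 ▸ Submodule.subset_span ⟨j, rfl⟩ : g j ∈ T'.polyInvariants)
  let e : I × J → MvPolynomial (σ ⊕ τ) ℝ := fun i => sumProd (f i.1) (g i.2)
  let b : I × J → ℕ := fun i => min (T.weight (f i.1)) (T'.weight (g i.2))
  let t : {h : (I × J) × ℕ // h.2 ≤ b h.1} → MvPolynomial (σ ⊕ τ) ℝ := fun h =>
    transvectant T T' (f h.1.1.1) (g h.1.1.2) h.1.2
  have he : LinearIndependent ℝ e := linearIndependent_sumProd hf.1 hg.1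
  have heX : ∀ i, (T.left σ τ).opX (e i) = 0 := fun i => by
    rw [Sl2Triad.opX_left_sumProd, hfX, map_zero, LinearMap.zero_apply]
  have heX' : ∀ i, (T'.right σ τ).opX (e i) = 0 := fun i => by
    rw [Sl2Triad.opX_right_sumProd, hgX, map_zero]
  have heZ : ∀ i, (T.left σ τ).opZ (e i) = (T.weight (f i.1) : ℝ) • e i := fun i => by
    rw [Sl2Triad.opZ_left_sumProd, hfZ, map_smul, LinearMap.smul_apply]
  have heZ' : ∀ i, (T'.right σ τ).opZ (e i) = (T'.weight (g i.2) : ℝ) • e i := fun i => by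
    rw [Sl2Triad.opZ_right_sumProd, hgZ, map_smul]
  have hlead := fun h : {h : (I × J) × ℕ // h.2 ≤ b h.1} =>
    exists_pow_opX_left_transvectant (T' := T') (g := g h.1.1.2) (hfX h.1.1.1) (hfZ h.1.1.1)
      (h.2.trans (min_le_left _ _))
  choose κ hκ ht using hlead
  have hker : ∀ h, (T.directSum T').opX (t h) = 0 := fun h =>
    opX_transvectant (hfX _) (hfZ _) (hgX _) (hgZ _) (h.2.trans (min_le_left _ _))
      (h.2.trans (min_le_right _ _))
  refine ⟨linearIndependent_of_leading (t := t) he heX hκ ht, le_antisymm ?_ ?_⟩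
  · rw [Submodule.span_le]
    rintro _ ⟨h, rfl⟩
    exact hker h
  · rw [Sl2Triad.polyInvariants]
    rw [T.opX_directSum] at hker ⊢
    refine ker_add_le_span_of_leading (e := e) (t := t) (κ := κ) (T.opX_left_opX_right_comm T') ?_
      (T.left σ τ).exists_pow_opX_eq_zero ?_ hker hκ ht
    · intro v hl hr
      obtain ⟨c, hc⟩ := Finsupp.mem_span_range_iff_exists_finsupp.1
        (mem_span_sumProd_of_opX_eq_zero T T' hf.2 hg.2 hl hr)
      exact ⟨c.support, c, hc.symm⟩
    · intro N v s c hv hN i hi hc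
      -- Up to sign, both operators give the same leading term, so it is bounded by both weights.
      have hpow : ∀ n : ℕ, ((T'.right σ τ).opX ^ n) v =
          (-1 : ℝ) ^ n • ((T.left σ τ).opX ^ n) v := by
        intro n
        induction n with
        | zero => simp
        | succ n ih =>
          have hcomm : Commute (T'.right σ τ).opX ((T.left σ τ).opX ^ n) :=
            Commute.pow_right
              (LinearMap.ext fun h => (T.opX_left_opX_right_comm T' h).symm) n
          have h1 : (T'.right σ τ).opX (((T.left σ τ).opX ^ n) v) =
            ((T.left σ τ).opX ^ n) ((T'.right σ τ).opX v) := LinearMap.congr_fun hcomm v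
          rw [LinearMap.add_apply] at hv
          rw [pow_succ', Module.End.mul_apply, ih, map_smul, h1, eq_neg_of_add_eq_zero_right hv,
            map_neg, ← Module.End.mul_apply, ← pow_succ, pow_succ (-1 : ℝ), mul_smul,
            neg_one_smul]
      obtain ⟨M, hM⟩ := (T.left σ τ).exists_pow_opY_eq_zero v
      obtain ⟨M', hM'⟩ := (T'.right σ τ).exists_pow_opY_eq_zero v
      refine le_min ((T.left σ τ).isSl2Rep.le_weight_of_pow_X he heX heZ hM hN hi hc)
        ((T'.right σ τ).isSl2Rep.le_weight_of_pow_X he heX' heZ' hM'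
          (c := fun i => (-1) ^ N * c i) ?_ hi (mul_ne_zero (by simp) hc))
      rw [hpow, hN, Finset.smul_sum]
      simp only [smul_smul]

end TransvectantBasis

/-! ### The pre-box product -/

section PreBox

variable {σ τ : Type} [Fintype σ] [Fintype τ] {T : Sl2Triad σ} {T' : Sl2Triad τ} {p q : ℕ}
  {α : Fin p → MvPolynomial σ ℝ} {β : Fin q → MvPolynomial τ ℝ}
  {A : Set (Fin p →₀ ℕ)} {B : Set (Fin q →₀ ℕ)}

theorem IsStandardPreferredSet.isVectorSpaceBasis (hα : IsHilbertBasis T α)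
    (hA : IsStandardPreferredSet T α A) :
    IsVectorSpaceBasis (fun k : A => monomialIn α k.1) T.polyInvariants := by
  choose d hd using hα.exists_isHomogeneous_monomialIn
  exact hA.formalBasis.isVectorSpaceBasis (fun k : A => hd k.1) fun k => hα.monomialIn_ne_zero k.1

theorem isVectorSpaceBasis_preBox (hα : IsHilbertBasis T α) (hβ : IsHilbertBasis T' β)
    (hA : IsStandardPreferredSet T α A) (hB : IsStandardPreferredSet T' β B) :
    IsVectorSpaceBasis (preBox T T' α β A B) (T.directSum T').polyInvariants := by
  have h := isVectorSpaceBasis_transvectant (hA.isVectorSpaceBasis hα) (hB.isVectorSpaceBasis hβ)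
    (fun k => by rw [hα.weight_monomialIn, hα.opZ_monomialIn])
    (fun k => by rw [hβ.weight_monomialIn, hβ.opZ_monomialIn])
  let φ : admissible T T' α β A B ≃ {h : (A × B) × ℕ // h.2 ≤
      min (T.weight (monomialIn α h.1.1.1)) (T'.weight (monomialIn β h.1.2.1))} :=
    { toFun := fun h => ⟨((⟨h.1.1, h.2.1⟩, ⟨h.1.2.1, h.2.2.1⟩), h.1.2.2), by
        rw [hα.weight_monomialIn, hβ.weight_monomialIn]
        exact le_min h.2.2.2.1 h.2.2.2.2⟩
      invFun := fun h => ⟨(h.1.1.1.1, h.1.1.2.1, h.1.2), h.1.1.1.2, h.1.1.2.2, by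
        have h2 := h.2
        rw [hα.weight_monomialIn, hβ.weight_monomialIn] at h2
        exact le_min_iff.1 h2⟩
      left_inv := fun _ => rfl
      right_inv := fun _ => rfl }
  exact ⟨h.1.comp φ φ.injective, h.2 ▸ congrArg (Submodule.span ℝ) (φ.surjective.range_comp fun h =>
    transvectant T T' (monomialIn α h.1.1.1.1) (monomialIn β h.1.1.2.1) h.1.2)⟩

end PreBox

end BoxProduct
end

theorem theorem8p4 {n m p q : ℕ}
    (T : BoxProduct.Sl2Triad (Fin n)) (T' : BoxProduct.Sl2Triad (Fin m))
    (α : Fin p → MvPolynomial (Fin n) ℝ) (β : Fin q → MvPolynomial (Fin m) ℝ)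
    (hα : BoxProduct.IsHilbertBasis T α) (hβ : BoxProduct.IsHilbertBasis T' β)
    (A : Set (Fin p →₀ ℕ)) (B : Set (Fin q →₀ ℕ))
    (hA : BoxProduct.IsStandardPreferredSet T α A)
    (hB : BoxProduct.IsStandardPreferredSet T' β B) :
    BoxProduct.IsVectorSpaceBasis (BoxProduct.preBox T T' α β A B)
        (T.directSum T').polyInvariants ∧
      BoxProduct.IsFormalBasis
        (fun h => (BoxProduct.preBox T T' α β A B h : MvPowerSeries (Fin n ⊕ Fin m) ℝ))
        (T.directSum T').formalInvariants := by
  have h := BoxProduct.isVectorSpaceBasis_preBox hα hβ hA hB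
  choose d hd using hα.exists_isHomogeneous_monomialIn
  choose d' hd' using hβ.exists_isHomogeneous_monomialIn
  exact ⟨h, h.isFormalBasis fun i =>
    BoxProduct.isHomogeneous_transvectant (hd i.1.1) (hd' i.1.2.1) i.1.2.2⟩
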